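/- **Setting.** For $A\in\mathbb{C}^{m\times d}$ and $k\ge 0$ let $\|A\|_2^{(k)}$ be the largest spectral norm over all $k$-column submatrices of $A$ (if $k>d$, the spectral norm of $A$). For $A,\Phi\in\mathbb{C}^{m\times d}$ put $\varepsilon_A^{(k)}=\|A-\Phi\|_2^{(k)}/\|A\|_2^{(k)}$. A vector is $s$-sparse if it has at most $s$ non-zero components. $A$ satisfies the restricted isometry property with constant (RIC) $\delta_k$ if $(1-\delta_k)\|z\|_2^2\le\|Az\|_2^2\le(1+\delta_k)\|z\|_2^2$ for every $k$-sparse $z\in\mathbb{C}^d$. For a vector $w$, $w_k$ denotes the vector that keeps the $k$ components of $w$ largest in magnitude (ties broken arbitrarily; all components if $k\ge d$) and is zero elsewhere. CoSaMP with measurement matrix $\Phi$, measurement vector $y$ and sparsity level $s$ starts from $a^0=0$ and obtains $a^{k}$ from $a^{k-1}$ ($k\ge1$) as follows: $u=\Phi^*(y-\Phi a^{k-1})$; $T=\operatorname{supp}(u_{2s})\cup\operatorname{supp}(a^{k-1})$; $w|_T=\Phi_T^\dagger y$ and $w|_{T^c}=0$, where $\Phi_T$ consists of the columns of $\Phi$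 indexed by $T$ and $\dagger$ is the Moore–Penrose pseudoinverse; $a^{k}=w_s$. The reconstruction $x^\sharp$ is the approximation $a^k$ at which the iteration is halted. **Corollary 2.3.** There is an absolute constant $C>0$ and, for each $s$, a number of iterations $K(s)$ depending only on $s$, such that the following holds for all $m,d$ and all $A,\Phi\in\mathbb{C}^{m\times d}$. Suppose that $A$ has RIC $$\delta_{4s}\le\frac{1.1}{\bigl(1+\varepsilon_A^{(4s)}\bigr)^2}-1 .$$ Let $x\in\mathbb{C}^d$ be $s$-sparse, $b=Ax$, and $y=b+e=Ax+e$ with $e\in\mathbb{C}^m$ arbitrary. Let $x^\sharp=a^k$ be the reconstruction from CoSaMP run with the decoding matrix $\Phi$ (instead of $A$) on $y$ with sparsity level $s$, halted after any number $k\ge K(s)$ of iterations. Then $$\|x^\sharp-x\|_2\le C\left(\|A-\Phi\|_2^{(s)}\,\|b\|_2+\|e\|_2\right).$$ -/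

import Mathlib

namespace CoSaMP

/-- The support of a vector. -/
noncomputable def supp {d : ℕ} (x : EuclideanSpace ℂ (Fin d)) : Finset (Fin d) :=
  Finset.univ.filter fun i => x i ≠ 0

/-- `x` is `s`-sparse: it has at most `s` non-zero components. -/
def IsSparse {d : ℕ} (s : ℕ) (x : EuclideanSpace ℂ (Fin d)) : Prop :=
  (supp x).card ≤ s

/-- The matrix-vector product, with Euclidean vectors. -/
noncomputable def app {m d : ℕ} (A : Matrix (Fin m) (Fin d) ℂ) (x : EuclideanSpace ℂ (Fin d)) :
    EuclideanSpace ℂ (Fin m) :=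
  WithLp.toLp 2 (A.mulVec x)

/-- The restricted isometry property with parameters `(s, δ)`. -/
def RIP {m d : ℕ} (A : Matrix (Fin m) (Fin d) ℂ) (s : ℕ) (δ : ℝ) : Prop :=
  ∀ x : EuclideanSpace ℂ (Fin d), IsSparse s x →
    (1 - δ) * ‖x‖ ^ 2 ≤ ‖app A x‖ ^ 2 ∧ ‖app A x‖ ^ 2 ≤ (1 + δ) * ‖x‖ ^ 2

open scoped Matrix.Norms.L2Operator in
/-- The spectral norm (largest singular value) of the submatrix `A_T` formed by the columns of `A`
indexed by `T`. -/
noncomputable def columnNorm {m d : ℕ} (A : Matrix (Fin m) (Fin d) ℂ) (T : Finset (Fin d)) : ℝ :=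
  ‖(A.submatrix id (fun i : {i // i ∈ T} => (i : Fin d)))‖

/-- The largest spectral norm over all `k`-column submatrices of `A`. Submatrices with fewer than
`k` columns are admitted too; this does not change the value if `k ≤ d` (deleting columns does not
increase the spectral norm), and if `k > d` it gives the spectral norm of `A`. -/
noncomputable def subNorm {m d : ℕ} (A : Matrix (Fin m) (Fin d) ℂ) (k : ℕ) : ℝ :=
  ⨆ T : {T : Finset (Fin d) // T.card ≤ k}, columnNorm A T

/-- The relative perturbation of the `k`-column submatrices. -/
noncomputable def relPert {m d : ℕ} (A Φ : Matrix (Fin m) (Fin d) ℂ) (k : ℕ) : ℝ :=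
  subNorm (A - Φ) k / subNorm A k

/-- `z` is `w_k`, the vector consisting of the `k` largest components of `w` in magnitude (all of
them if `k ≥ d`), for some way of breaking ties. -/
def IsHead {d : ℕ} (k : ℕ) (w z : EuclideanSpace ℂ (Fin d)) : Prop :=
  ∃ S : Finset (Fin d), S.card = min k d ∧ (∀ i ∈ S, ∀ j ∉ S, ‖w j‖ ≤ ‖w i‖) ∧
    (∀ i ∈ S, z i = w i) ∧ ∀ i ∉ S, z i = 0

/-- `w` is a least-squares solution of `A w ≈ y` among the vectors supported in `T`. -/
def IsLeastSquares {m d : ℕ} (A : Matrix (Fin m) (Fin d) ℂ) (y : EuclideanSpace ℂ (Fin m))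
    (T : Finset (Fin d)) (w : EuclideanSpace ℂ (Fin d)) : Prop :=
  supp w ⊆ T ∧ ∀ z : EuclideanSpace ℂ (Fin d), supp z ⊆ T → ‖y - app A w‖ ≤ ‖y - app A z‖

/-- `w|_T = A_T^† y` and `w|_{T^c} = 0`, where `A_T^†` is the Moore-Penrose pseudoinverse:
`w` is the least-squares solution of smallest norm. -/
def IsPinvSolution {m d : ℕ} (A : Matrix (Fin m) (Fin d) ℂ) (y : EuclideanSpace ℂ (Fin m))
    (T : Finset (Fin d)) (w : EuclideanSpace ℂ (Fin d)) : Prop :=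
  IsLeastSquares A y T w ∧ ∀ z, IsLeastSquares A y T z → ‖w‖ ≤ ‖z‖

/-- One iteration of CoSaMP with measurement matrix `A`, measurement vector `y` and sparsity level
`s`, from the approximation `a` to the approximation `a'`: with `v = y - A a`, form the proxy
`u = A^* v`, merge the support of `u_{2s}` with that of `a`, estimate by least squares on the
merged support, and prune to the `s` largest components. -/
def IsStep {m d : ℕ} (A : Matrix (Fin m) (Fin d) ℂ) (y : EuclideanSpace ℂ (Fin m)) (s : ℕ)
    (a a' : EuclideanSpace ℂ (Fin d)) : Prop :=
  ∃ u₂ w : EuclideanSpace ℂ (Fin d),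
    IsHead (2 * s) (app A.conjTranspose (y - app A a)) u₂ ∧
    IsPinvSolution A y (supp u₂ ∪ supp a) w ∧
    IsHead s w a'

/-- `a` is the sequence of approximations `a⁰, a¹, a², …` of a run of CoSaMP with measurement
matrix `A`, measurement vector `y` and sparsity level `s` (ties being broken arbitrarily). -/
def IsRun {m d : ℕ} (A : Matrix (Fin m) (Fin d) ℂ) (y : EuclideanSpace ℂ (Fin m)) (s : ℕ)
    (a : ℕ → EuclideanSpace ℂ (Fin d)) : Prop :=
  a 0 = 0 ∧ ∀ k, IsStep A y s (a k) (a (k + 1))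


/-- There is always a choice of the `k` largest components. -/
theorem exists_isHead {d : ℕ} (k : ℕ) (w : EuclideanSpace ℂ (Fin d)) : ∃ z, IsHead k w z := by
  suffices h : ∀ n ≤ d, ∃ S : Finset (Fin d), S.card = n ∧ ∀ i ∈ S, ∀ j ∉ S, ‖w j‖ ≤ ‖w i‖ by
    obtain ⟨S, hS, hw⟩ := h (min k d) (min_le_right _ _)
    refine ⟨WithLp.toLp 2 fun i => if i ∈ S then w i else 0, S, hS, hw, ?_, ?_⟩
    · intro i hi
      simp [hi]
    · intro i hi
      simp [hi]
  intro n
  induction n with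
  | zero => exact fun _ => ⟨∅, by simp, by simp⟩
  | succ n ih =>
    intro hn
    obtain ⟨S, hS, hw⟩ := ih (by omega)
    have hne : (Sᶜ : Finset (Fin d)).Nonempty := by
      rw [← Finset.card_pos, Finset.card_compl, Fintype.card_fin]
      omega
    obtain ⟨p, hp, hmax⟩ := Finset.exists_max_image Sᶜ (fun j => ‖w j‖) hne
    rw [Finset.mem_compl] at hp
    refine ⟨insert p S, by rw [Finset.card_insert_of_notMem hp, hS], ?_⟩
    intro i hi j hj
    rw [Finset.mem_insert, not_or] at hj
    rcases Finset.mem_insert.1 hi with rfl | hi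
    · exact hmax j (Finset.mem_compl.2 hj.2)
    · exact hw i hi j hj.2

/-- The vector `A_T^† y`, extended by zero, exists. -/
theorem exists_isPinvSolution {m d : ℕ} (A : Matrix (Fin m) (Fin d) ℂ)
    (y : EuclideanSpace ℂ (Fin m)) (T : Finset (Fin d)) : ∃ w, IsPinvSolution A y T w := by
  let V : Submodule ℂ (EuclideanSpace ℂ (Fin d)) :=
    { carrier := {z | ∀ i ∉ T, z i = 0}
      add_mem' := fun ha hb i hi => by simp [ha i hi, hb i hi]
      zero_mem' := fun i _ => by simp
      smul_mem' := fun c z hz i hi => by simp [hz i hi] }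
  have hV : ∀ z, z ∈ V ↔ supp z ⊆ T := fun z => by
    constructor
    · intro h i hi
      by_contra hc
      exact (Finset.mem_filter.1 hi).2 (h i hc)
    · intro h i hi
      by_contra hc
      exact hi (h (Finset.mem_filter.2 ⟨Finset.mem_univ _, hc⟩))
  have happ : ∀ z, app A z = Matrix.toEuclideanLin A z := fun z => rfl
  have hcont : Continuous (app A) :=
    (Matrix.toEuclideanLin A).continuous_of_finiteDimensional
  let R : Submodule ℂ (EuclideanSpace ℂ (Fin m)) := V.map (Matrix.toEuclideanLin A)
  obtain ⟨_, ⟨w₀, hw₀, rfl⟩, hdist⟩ :=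
    (Submodule.closed_of_finiteDimensional R).exists_infDist_eq_dist ⟨0, R.zero_mem⟩ y
  have hls : IsLeastSquares A y T w₀ := by
    refine ⟨(hV w₀).1 hw₀, fun z hz => ?_⟩
    have := Metric.infDist_le_dist_of_mem (x := y)
      (show Matrix.toEuclideanLin A z ∈ (R : Set _) from ⟨z, (hV z).2 hz, rfl⟩)
    rw [hdist, dist_eq_norm, dist_eq_norm] at this
    exact this
  have hclosed : IsClosed {z | IsLeastSquares A y T z} := by
    have : {z | IsLeastSquares A y T z} =
        (V : Set _) ∩ {z | ‖y - app A z‖ ≤ ‖y - app A w₀‖} := by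
      ext z
      constructor
      · exact fun h => ⟨(hV z).2 h.1, h.2 w₀ hls.1⟩
      · exact fun h => ⟨(hV z).1 h.1, fun z' hz' => le_trans h.2 (hls.2 z' hz')⟩
    rw [this]
    exact (Submodule.closed_of_finiteDimensional V).inter
      (isClosed_le (continuous_const.sub hcont).norm continuous_const)
  obtain ⟨w, hw, hd⟩ := hclosed.exists_infDist_eq_dist ⟨w₀, hls⟩ 0
  refine ⟨w, hw, fun z hz => ?_⟩
  have := Metric.infDist_le_dist_of_mem (x := (0 : EuclideanSpace ℂ (Fin d)))
    (show z ∈ {z | IsLeastSquares A y T z} from hz)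
  rw [hd, dist_zero_left, dist_zero_left] at this
  exact this

/-- CoSaMP can always be run. -/
theorem exists_isRun {m d : ℕ} (A : Matrix (Fin m) (Fin d) ℂ) (y : EuclideanSpace ℂ (Fin m))
    (s : ℕ) : ∃ a, IsRun A y s a := by
  have hstep : ∀ a, ∃ a', IsStep A y s a a' := fun a => by
    obtain ⟨u₂, hu⟩ := exists_isHead (2 * s) (app A.conjTranspose (y - app A a))
    obtain ⟨w, hw⟩ := exists_isPinvSolution A y (supp u₂ ∪ supp a)
    obtain ⟨a', ha'⟩ := exists_isHead s w
    exact ⟨a', u₂, w, hu, hw, ha'⟩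
  choose f hf using hstep
  exact ⟨fun k => Nat.rec 0 (fun _ a => f a) k, rfl, fun k => hf _⟩

end CoSaMP

namespace CoSaMP

/-! ### Linearity, supports and restrictions -/

variable {m d : ℕ}

/-! The perturbation of the matrix is treated as noise. The hypothesis on `δ` forces `Φ` to satisfy
the RIP of order `4s` with constant 0.1 (`RIP.perturb`), and `y = Φx + ((A - Φ)x + e)`, so the run
is an ordinary CoSaMP run with noise of size at most `‖A - Φ‖ ‖x‖ + ‖e‖`, where `‖x‖` is comparable
with `‖Ax‖`.

For CoSaMP itself, let `M k` be the norm of `x` off the support merged in step `k`. Identification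
bounds `M k` by the current error, and least squares followed by pruning bounds the next error by `M
k`. Hence `M (k + 1) ≤ M k / 2 + c`, with `c` of the order of the noise.

This geometric decay alone gives an iteration count depending on the size of `x`. A count depending
only on `s` comes from `le_of_halving`: while positive, `M k` lies within a factor `s` of one of the
at most `s` nonzero entries of `x`. Each block of `s + 1` steps brings `M` strictly below one more
entry, unless the noise level is reached, so `s + 1` blocks suffice. -/

theorem app_add (A : Matrix (Fin m) (Fin d) ℂ) (u v : EuclideanSpace ℂ (Fin d)) :
    app A (u + v) = app A u + app A v :=
  map_add (Matrix.toEuclideanLin A) u v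

theorem app_sub (A : Matrix (Fin m) (Fin d) ℂ) (u v : EuclideanSpace ℂ (Fin d)) :
    app A (u - v) = app A u - app A v :=
  map_sub (Matrix.toEuclideanLin A) u v

theorem app_smul (A : Matrix (Fin m) (Fin d) ℂ) (c : ℂ) (u : EuclideanSpace ℂ (Fin d)) :
    app A (c • u) = c • app A u :=
  map_smul (Matrix.toEuclideanLin A) c u

theorem sub_app (A B : Matrix (Fin m) (Fin d) ℂ) (u : EuclideanSpace ℂ (Fin d)) :
    app (A - B) u = app A u - app B u := by
  ext i
  simp [app, Matrix.sub_mulVec]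

theorem inner_app_left (A : Matrix (Fin m) (Fin d) ℂ) (u : EuclideanSpace ℂ (Fin d))
    (v : EuclideanSpace ℂ (Fin m)) :
    inner ℂ (app A u) v = inner ℂ u (app A.conjTranspose v) := by
  have h : app A.conjTranspose v = LinearMap.adjoint (Matrix.toEuclideanLin A) v := by
    rw [← Matrix.toEuclideanLin_conjTranspose_eq_adjoint]
    rfl
  rw [h, LinearMap.adjoint_inner_right]
  rfl

theorem mem_supp {x : EuclideanSpace ℂ (Fin d)} {i : Fin d} : i ∈ supp x ↔ x i ≠ 0 := by
  simp [supp]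

theorem supp_subset_iff {x : EuclideanSpace ℂ (Fin d)} {T : Finset (Fin d)} :
    supp x ⊆ T ↔ ∀ i ∉ T, x i = 0 := by
  constructor
  · intro h i hi
    by_contra hc
    exact hi (h (mem_supp.2 hc))
  · intro h i hi
    by_contra hc
    exact mem_supp.1 hi (h i hc)

theorem supp_sub_subset {u v : EuclideanSpace ℂ (Fin d)} {T : Finset (Fin d)}
    (hu : supp u ⊆ T) (hv : supp v ⊆ T) : supp (u - v) ⊆ T := by
  rw [supp_subset_iff] at *
  intro i hi
  simp [hu i hi, hv i hi]

theorem supp_add_subset {u v : EuclideanSpace ℂ (Fin d)} {T : Finset (Fin d)}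
    (hu : supp u ⊆ T) (hv : supp v ⊆ T) : supp (u + v) ⊆ T := by
  rw [supp_subset_iff] at *
  intro i hi
  simp [hu i hi, hv i hi]

theorem supp_smul_subset {u : EuclideanSpace ℂ (Fin d)} {T : Finset (Fin d)} (c : ℂ)
    (hu : supp u ⊆ T) : supp (c • u) ⊆ T := by
  rw [supp_subset_iff] at *
  intro i hi
  simp [hu i hi]

/-- The restriction of a vector to a set of components, extended by zero. -/
noncomputable def restr (T : Finset (Fin d)) (x : EuclideanSpace ℂ (Fin d)) :
    EuclideanSpace ℂ (Fin d) :=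
  WithLp.toLp 2 fun i => if i ∈ T then x i else 0

theorem restr_apply (T : Finset (Fin d)) (x : EuclideanSpace ℂ (Fin d)) (i : Fin d) :
    restr T x i = if i ∈ T then x i else 0 := rfl

theorem supp_restr_subset (T : Finset (Fin d)) (x : EuclideanSpace ℂ (Fin d)) :
    supp (restr T x) ⊆ T :=
  supp_subset_iff.2 fun i hi => by simp [restr_apply, hi]

theorem norm_restr_sq (T : Finset (Fin d)) (x : EuclideanSpace ℂ (Fin d)) :
    ‖restr T x‖ ^ 2 = ∑ i ∈ T, ‖x i‖ ^ 2 := by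
  rw [EuclideanSpace.norm_sq_eq, ← Finset.sum_filter_add_sum_filter_not _ (· ∈ T)]
  have h1 : ∑ i with i ∉ T, ‖restr T x i‖ ^ 2 = 0 := by
    refine Finset.sum_eq_zero fun i hi => ?_
    simp [restr_apply, (Finset.mem_filter.1 hi).2]
  rw [h1, add_zero, Finset.filter_univ_mem]
  refine Finset.sum_congr rfl fun i hi => by simp [restr_apply, hi]

theorem restr_add_restr_compl (T : Finset (Fin d)) (x : EuclideanSpace ℂ (Fin d)) :
    restr T x + restr Tᶜ x = x := by
  ext i
  by_cases hi : i ∈ T <;> simp [restr_apply, hi]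

theorem inner_restr_left (T : Finset (Fin d)) (x y : EuclideanSpace ℂ (Fin d)) :
    inner ℂ (restr T x) y = inner ℂ (restr T x) (restr T y) := by
  simp only [PiLp.inner_apply, restr_apply]
  refine Finset.sum_congr rfl fun i _ => ?_
  split_ifs <;> simp

theorem re_inner_restr_self (T : Finset (Fin d)) (x : EuclideanSpace ℂ (Fin d)) :
    RCLike.re (inner ℂ (restr T x) x) = ‖restr T x‖ ^ 2 := by
  rw [inner_restr_left, ← norm_sq_eq_re_inner (𝕜 := ℂ)]

theorem norm_restr_mono {S T : Finset (Fin d)} (h : S ⊆ T) (x : EuclideanSpace ℂ (Fin d)) :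
    ‖restr S x‖ ≤ ‖restr T x‖ := by
  refine le_of_sq_le_sq ?_ (norm_nonneg _)
  rw [norm_restr_sq, norm_restr_sq]
  exact Finset.sum_le_sum_of_subset_of_nonneg h fun i _ _ => sq_nonneg _

/-! ### Restricted isometry and least squares -/

/-- The restricted isometry property controls the inner products of vectors with a common small
support. -/
theorem RIP.abs_re_inner_sub_le {A : Matrix (Fin m) (Fin d) ℂ} {n : ℕ} {δ : ℝ} (h : RIP A n δ)
    {T : Finset (Fin d)} (hT : T.card ≤ n) {u v : EuclideanSpace ℂ (Fin d)}
    (hu : supp u ⊆ T) (hv : supp v ⊆ T) :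
    |RCLike.re (inner ℂ (app A u) (app A v)) - RCLike.re (inner ℂ u v)| ≤ δ * (‖u‖ * ‖v‖) := by
  -- Polarization: the RIP bounds at `u + v` and `u - v` are combined.
  have key : ∀ u v : EuclideanSpace ℂ (Fin d), supp u ⊆ T → supp v ⊆ T →
      |RCLike.re (inner ℂ (app A u) (app A v)) - RCLike.re (inner ℂ u v)| ≤
        δ * ((‖u‖ ^ 2 + ‖v‖ ^ 2) / 2) := by
    intro u v hu hv
    obtain ⟨p1, p2⟩ := h (u + v) ((Finset.card_le_card (supp_add_subset hu hv)).trans hT)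
    obtain ⟨q1, q2⟩ := h (u - v) ((Finset.card_le_card (supp_sub_subset hu hv)).trans hT)
    rw [app_add, norm_add_sq (𝕜 := ℂ), norm_add_sq (𝕜 := ℂ)] at p1 p2
    rw [app_sub, norm_sub_sq (𝕜 := ℂ), norm_sub_sq (𝕜 := ℂ)] at q1 q2
    rw [abs_le]
    constructor <;> linarith
  rcases eq_or_lt_of_le (norm_nonneg u) with h0 | hu0
  · rw [eq_comm, norm_eq_zero] at h0
    subst h0
    have : app A 0 = 0 := map_zero (Matrix.toEuclideanLin A)
    simp [this]
  rcases eq_or_lt_of_le (norm_nonneg v) with h0 | hv0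
  · rw [eq_comm, norm_eq_zero] at h0
    subst h0
    have : app A 0 = 0 := map_zero (Matrix.toEuclideanLin A)
    simp [this]
  -- Rescaling both vectors to norm `‖u‖ ‖v‖` turns the arithmetic mean in `key` into a product.
  have := key ((‖v‖ : ℂ) • u) ((‖u‖ : ℂ) • v) (supp_smul_subset _ hu) (supp_smul_subset _ hv)
  have e1 : ∀ {n : ℕ} (p q : EuclideanSpace ℂ (Fin n)),
      RCLike.re (inner ℂ ((‖v‖ : ℂ) • p) ((‖u‖ : ℂ) • q)) =
        ‖u‖ * ‖v‖ * RCLike.re (inner ℂ p q) := by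
    intro n p q
    rw [inner_smul_left, inner_smul_right, Complex.conj_ofReal, ← mul_assoc, ← Complex.ofReal_mul]
    simp [mul_comm]
  rw [app_smul, app_smul, e1, e1, norm_smul, norm_smul, Complex.norm_real, Complex.norm_real,
    norm_norm, norm_norm, ← mul_sub, abs_mul, abs_of_pos (mul_pos hu0 hv0)] at this
  refine le_of_mul_le_mul_left (this.trans (le_of_eq ?_)) (mul_pos hu0 hv0)
  ring

/-- The upper restricted isometry bound as a bound of norms. -/
theorem RIP.norm_app_le {A : Matrix (Fin m) (Fin d) ℂ} {n : ℕ} (h : RIP A n 0.1)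
    {u : EuclideanSpace ℂ (Fin d)} (hu : IsSparse n u) : ‖app A u‖ ≤ 1.05 * ‖u‖ := by
  refine le_of_sq_le_sq ?_ (by positivity)
  nlinarith [(h u hu).2, sq_nonneg ‖u‖]

/-- The residual of a least-squares solution is orthogonal to the columns in use. -/
theorem IsLeastSquares.re_inner_nonpos {A : Matrix (Fin m) (Fin d) ℂ}
    {y : EuclideanSpace ℂ (Fin m)} {T : Finset (Fin d)} {w : EuclideanSpace ℂ (Fin d)}
    (h : IsLeastSquares A y T w) {z : EuclideanSpace ℂ (Fin d)} (hz : supp z ⊆ T) :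
    RCLike.re (inner ℂ (app A z) (y - app A w)) ≤ 0 := by
  by_contra! hc
  -- First-order optimality: compare `w` with the competitor `w + t z`.
  have key : ∀ t : ℝ, 2 * t * RCLike.re (inner ℂ (app A z) (y - app A w)) ≤
      t ^ 2 * ‖app A z‖ ^ 2 := by
    intro t
    have h1 := h.2 (w + (t : ℂ) • z) (supp_add_subset h.1 (supp_smul_subset _ hz))
    rw [app_add, app_smul, ← sub_sub] at h1
    have h2 := pow_le_pow_left₀ (norm_nonneg _) h1 2
    rw [norm_sub_sq (𝕜 := ℂ) (y - app A w), inner_smul_right, norm_smul, Complex.norm_real,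
      mul_pow, Real.norm_eq_abs, sq_abs] at h2
    have e : RCLike.re ((t : ℂ) * inner ℂ (y - app A w) (app A z)) =
        t * RCLike.re (inner ℂ (app A z) (y - app A w)) := by
      rw [inner_re_symm (app A z)]
      exact Complex.re_ofReal_mul _ _
    linarith
  set c := RCLike.re (inner ℂ (app A z) (y - app A w))
  have hN : 0 < ‖app A z‖ ^ 2 + 1 := by positivity
  -- Near-optimal `t`; the added 1 avoids dividing by zero when `app A z = 0`.
  have := key (c / (‖app A z‖ ^ 2 + 1))
  have h3 : c / (‖app A z‖ ^ 2 + 1) * (‖app A z‖ ^ 2 + 1) = c := div_mul_cancel₀ _ hN.ne'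
  have h4 : 0 < c / (‖app A z‖ ^ 2 + 1) := div_pos hc hN
  set t := c / (‖app A z‖ ^ 2 + 1)
  nlinarith [mul_pos h4 hc, mul_pos h4 h4]

/-! ### Largest components -/

/-- A set of largest components carries at least as much energy as any set of at most the same
size; common components are left out. -/
theorem sum_sdiff_le_sum_sdiff {w : EuclideanSpace ℂ (Fin d)} {S X : Finset (Fin d)}
    (hS : ∀ i ∈ S, ∀ j ∉ S, ‖w j‖ ≤ ‖w i‖) (hX : X.card ≤ S.card) :
    ∑ i ∈ X \ S, ‖w i‖ ^ 2 ≤ ∑ i ∈ S \ X, ‖w i‖ ^ 2 := by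
  have hcard : (X \ S).card ≤ (S \ X).card := by
    have h1 := Finset.card_sdiff_add_card_inter X S
    have h2 := Finset.card_sdiff_add_card_inter S X
    rw [Finset.inter_comm] at h2
    omega
  rcases (X \ S).eq_empty_or_nonempty with h0 | hne
  · rw [h0, Finset.sum_empty]
    exact Finset.sum_nonneg fun i _ => sq_nonneg _
  obtain ⟨p, hp, hmax⟩ := Finset.exists_max_image (X \ S) (fun j => ‖w j‖) hne
  calc ∑ i ∈ X \ S, ‖w i‖ ^ 2 ≤ (X \ S).card • ‖w p‖ ^ 2 :=
        Finset.sum_le_card_nsmul _ _ _ fun i hi =>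
          pow_le_pow_left₀ (norm_nonneg _) (hmax i hi) 2
    _ ≤ (S \ X).card • ‖w p‖ ^ 2 := nsmul_le_nsmul_left (sq_nonneg _) hcard
    _ ≤ ∑ i ∈ S \ X, ‖w i‖ ^ 2 :=
        Finset.card_nsmul_le_sum _ _ _ fun i hi =>
          pow_le_pow_left₀ (norm_nonneg _)
            (hS i (Finset.mem_sdiff.1 hi).1 p (Finset.mem_sdiff.1 hp).2) 2

theorem card_le_min {X : Finset (Fin d)} {k : ℕ} (h : X.card ≤ k) : X.card ≤ min k d :=
  le_min h (by simpa using Finset.card_le_univ X)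

theorem IsHead.isSparse {k : ℕ} {w z : EuclideanSpace ℂ (Fin d)} (h : IsHead k w z) :
    IsSparse k z := by
  obtain ⟨S, hS, -, -, h0⟩ := h
  exact (Finset.card_le_card (supp_subset_iff.2 h0)).trans (hS.trans_le (min_le_left _ _))

/-- The head of a vector is a best sparse approximation. -/
theorem IsHead.norm_sub_le {k : ℕ} {w z x : EuclideanSpace ℂ (Fin d)} (h : IsHead k w z)
    (hx : IsSparse k x) : ‖w - z‖ ≤ ‖x - w‖ := by
  obtain ⟨S, hS, hw, h1, h0⟩ := h
  have e1 : w - z = restr Sᶜ w := by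
    ext i
    by_cases hi : i ∈ S
    · simp [restr_apply, hi, h1 i hi]
    · simp [restr_apply, hi, h0 i hi]
  have e2 : restr (supp x)ᶜ w = restr (supp x)ᶜ (w - x) := by
    ext i
    by_cases hi : x i = 0 <;> simp [restr_apply, mem_supp, hi]
  have hle : ‖restr (supp x)ᶜ (w - x)‖ ≤ ‖w - x‖ := by
    have : restr Finset.univ (w - x) = w - x := by ext i; simp [restr_apply]
    calc _ ≤ ‖restr Finset.univ (w - x)‖ := norm_restr_mono (Finset.subset_univ _) _
      _ = _ := by rw [this]
  rw [norm_sub_rev x w]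
  refine le_trans ?_ hle
  rw [e1, ← e2]
  refine le_of_sq_le_sq ?_ (norm_nonneg _)
  have h2 := sum_sdiff_le_sum_sdiff hw (X := supp x) (by rw [hS]; exact card_le_min hx)
  have s1 : ∑ i, ‖w i‖ ^ 2 = ∑ i ∈ S, ‖w i‖ ^ 2 + ∑ i ∈ Sᶜ, ‖w i‖ ^ 2 :=
    (Finset.sum_add_sum_compl _ _).symm
  have s2 : ∑ i, ‖w i‖ ^ 2 = ∑ i ∈ supp x, ‖w i‖ ^ 2 + ∑ i ∈ (supp x)ᶜ, ‖w i‖ ^ 2 :=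
    (Finset.sum_add_sum_compl _ _).symm
  have s3 := Finset.sum_inter_add_sum_sdiff S (supp x) (fun i => ‖w i‖ ^ 2)
  have s4 := Finset.sum_inter_add_sum_sdiff (supp x) S (fun i => ‖w i‖ ^ 2)
  rw [Finset.inter_comm] at s4
  rw [norm_restr_sq, norm_restr_sq]
  linarith

/-- The `k` largest components of `u` dominate `u` on any set `R` of at most `k` components. -/
theorem IsHead.norm_restr_sdiff_le {k : ℕ} {u z : EuclideanSpace ℂ (Fin d)} (h : IsHead k u z)
    {R : Finset (Fin d)} (hR : R.card ≤ k) :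
    ‖restr (R \ supp z) u‖ ≤ ‖restr (supp z \ R) u‖ := by
  obtain ⟨S, hS, hw, h1, h0⟩ := h
  have h2 := sum_sdiff_le_sum_sdiff hw (X := R) (by rw [hS]; exact card_le_min hR)
  have hsub : supp z ⊆ S := supp_subset_iff.2 h0
  have hz : ∀ i ∈ S, i ∉ supp z → u i = 0 := fun i hi hn => by
    rw [mem_supp, not_not, h1 i hi] at hn
    exact hn
  refine le_of_sq_le_sq ?_ (norm_nonneg _)
  rw [norm_restr_sq, norm_restr_sq]
  -- The selected set `S` may exceed `supp z`, but only by indices where `u` vanishes.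
  have e1 : ∑ i ∈ R \ S, ‖u i‖ ^ 2 = ∑ i ∈ R \ supp z, ‖u i‖ ^ 2 := by
    refine Finset.sum_subset (Finset.sdiff_subset_sdiff subset_rfl hsub) fun i hi hn => ?_
    simp only [Finset.mem_sdiff] at hi hn
    rw [hz i (by tauto) hi.2]
    simp
  have e2 : ∑ i ∈ supp z \ R, ‖u i‖ ^ 2 = ∑ i ∈ S \ R, ‖u i‖ ^ 2 := by
    refine Finset.sum_subset (Finset.sdiff_subset_sdiff hsub subset_rfl) fun i hi hn => ?_
    simp only [Finset.mem_sdiff] at hi hn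
    rw [hz i hi.1 (by tauto)]
    simp
  rw [← e1, e2]
  exact h2

/-! ### One iteration of CoSaMP -/

/-- Identification: the proxy captures most of the energy of the error `r`. -/
theorem norm_restr_compl_le_of_isHead {Φ : Matrix (Fin m) (Fin d) ℂ} {s : ℕ}
    (h : RIP Φ (4 * s) 0.1) {r u : EuclideanSpace ℂ (Fin d)} {e : EuclideanSpace ℂ (Fin m)}
    (hr : IsSparse (2 * s) r)
    (hu : IsHead (2 * s) (app Φ.conjTranspose (app Φ r + e)) u) :
    ‖restr (supp u)ᶜ r‖ ≤ 0.2 * ‖r‖ + 2.1 * ‖e‖ := by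
  set p := app Φ.conjTranspose (app Φ r + e) with hp
  have hpin : ∀ z, RCLike.re (inner ℂ z p) =
      RCLike.re (inner ℂ (app Φ z) (app Φ r)) + RCLike.re (inner ℂ (app Φ z) e) := fun z => by
    rw [hp, ← inner_app_left, inner_add_right, map_add]
  have hcs : ∀ {n : ℕ} (a b : EuclideanSpace ℂ (Fin n)),
      |RCLike.re (inner ℂ a b)| ≤ ‖a‖ * ‖b‖ := fun a b =>
    (RCLike.abs_re_le_norm _).trans (norm_inner_le_norm _ _)
  have hcard : (supp r ∪ supp u).card ≤ 4 * s := by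
    have := Finset.card_union_le (supp r) (supp u)
    have := hu.isSparse
    unfold IsSparse at *
    omega
  have hrT : supp r ⊆ supp r ∪ supp u := Finset.subset_union_left
  -- `q` is the proxy on wrongly selected indices, `g` the part of `r` that the selection misses.
  set q := restr (supp u \ supp r) p with hq
  set g := restr (supp r \ supp u) r with hg
  have hqT : supp q ⊆ supp r ∪ supp u :=
    (supp_restr_subset _ _).trans (Finset.sdiff_subset.trans Finset.subset_union_right)
  have hgT : supp g ⊆ supp r ∪ supp u :=
    (supp_restr_subset _ _).trans (Finset.sdiff_subset.trans Finset.subset_union_left)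
  have hgr : restr (supp u)ᶜ r = g := by
    ext i
    by_cases hi : r i = 0 <;> simp [hg, restr_apply, mem_supp, hi]
  have hqr : RCLike.re (inner ℂ q r) = 0 := by
    have : restr (supp u \ supp r) r = 0 := by
      ext i
      by_cases hi : r i = 0 <;> simp [restr_apply, mem_supp, hi]
    rw [hq, inner_restr_left, this]
    simp
  -- Since `r` vanishes where `q` lives, only the RIP defect and the noise contribute to `⟨q, p⟩`.
  have bq : ‖q‖ ≤ 0.1 * ‖r‖ + 1.05 * ‖e‖ := by
    have h1 : ‖q‖ ^ 2 = RCLike.re (inner ℂ q p) := (re_inner_restr_self _ _).symm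
    rw [hpin] at h1
    have h2 := (abs_le.1 (h.abs_re_inner_sub_le hcard hqT hrT)).2
    have h3 := (abs_le.1 (hcs (app Φ q) e)).2
    have h4 := mul_le_mul_of_nonneg_right
      (h.norm_app_le ((Finset.card_le_card hqT).trans hcard)) (norm_nonneg e)
    rcases eq_or_lt_of_le (norm_nonneg q) with h0 | h0
    · rw [← h0]; positivity
    · refine le_of_mul_le_mul_left ?_ h0
      linarith
  -- On the missed indices the proxy is close to `r`, yet by the selection rule its norm there is at
  -- most `‖q‖`.
  have bg : ‖g‖ ≤ 0.1 * ‖r‖ + 1.05 * ‖e‖ + ‖q‖ := by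
    have h1 : ‖g‖ ^ 2 = RCLike.re (inner ℂ g r) := (re_inner_restr_self _ _).symm
    have h2 := (abs_le.1 (h.abs_re_inner_sub_le hcard hgT hrT)).1
    have h3 := (abs_le.1 (hcs (app Φ g) e)).1
    have h4 := mul_le_mul_of_nonneg_right
      (h.norm_app_le ((Finset.card_le_card hgT).trans hcard)) (norm_nonneg e)
    have h5 : RCLike.re (inner ℂ g p) ≤ ‖g‖ * ‖q‖ := by
      rw [hg, inner_restr_left]
      exact (abs_le.1 (hcs _ _)).2.trans
        (mul_le_mul_of_nonneg_left (hu.norm_restr_sdiff_le hr) (norm_nonneg _))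
    rw [hpin] at h5
    rcases eq_or_lt_of_le (norm_nonneg g) with h0 | h0
    · rw [← h0]; positivity
    · refine le_of_mul_le_mul_left ?_ h0
      linarith
  rw [hgr]
  linarith

/-- Estimation: least squares on `T` is accurate up to the energy of `x` outside of `T`. -/
theorem IsLeastSquares.norm_sub_le {Φ : Matrix (Fin m) (Fin d) ℂ} {s : ℕ}
    (h : RIP Φ (4 * s) 0.1) {x w : EuclideanSpace ℂ (Fin d)} {e : EuclideanSpace ℂ (Fin m)}
    {T : Finset (Fin d)} (hx : IsSparse s x) (hT : T.card ≤ 3 * s)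
    (hw : IsLeastSquares Φ (app Φ x + e) T w) :
    ‖x - w‖ ≤ 1.125 * ‖restr Tᶜ x‖ + 1.2 * ‖e‖ := by
  have hcard : (T ∪ supp x).card ≤ 4 * s := by
    have := Finset.card_union_le T (supp x)
    unfold IsSparse at *
    omega
  set g := restr T (x - w) with hg
  have hxT : supp (x - w) ⊆ T ∪ supp x :=
    supp_sub_subset Finset.subset_union_right (hw.1.trans Finset.subset_union_left)
  have hgT' : supp g ⊆ T := supp_restr_subset _ _
  have hgT : supp g ⊆ T ∪ supp x := hgT'.trans Finset.subset_union_left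
  have hc : restr Tᶜ (x - w) = restr Tᶜ x := by
    ext i
    by_cases hi : i ∈ T
    · simp [restr_apply, hi]
    · simp [restr_apply, hi, supp_subset_iff.1 hw.1 i hi]
  have h1 : ‖g‖ ^ 2 = RCLike.re (inner ℂ g (x - w)) := (re_inner_restr_self _ _).symm
  have h2 := (abs_le.1 (h.abs_re_inner_sub_le hcard hgT hxT)).1
  have h3 := hw.re_inner_nonpos hgT'
  rw [show app Φ x + e - app Φ w = app Φ (x - w) + e by rw [app_sub]; abel, inner_add_right,
    map_add] at h3
  have h4 : -(‖app Φ g‖ * ‖e‖) ≤ RCLike.re (inner ℂ (app Φ g) e) :=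
    (abs_le.1 ((RCLike.abs_re_le_norm _).trans (norm_inner_le_norm _ _))).1
  have h5 := mul_le_mul_of_nonneg_right
    (h.norm_app_le ((Finset.card_le_card hgT).trans hcard)) (norm_nonneg e)
  -- `‖g‖ ^ 2` is close to `⟨Φg, Φ(x - w)⟩`, which optimality of `w` bounds by the noise term.
  have h6 : ‖g‖ ≤ 0.1 * ‖x - w‖ + 1.05 * ‖e‖ := by
    rcases eq_or_lt_of_le (norm_nonneg g) with h0 | h0
    · rw [← h0]; positivity
    · refine le_of_mul_le_mul_left ?_ h0
      linarith
  have h7 : ‖x - w‖ ≤ ‖g‖ + ‖restr Tᶜ x‖ := by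
    rw [← hc]
    exact (congrArg _ (restr_add_restr_compl T (x - w)).symm).trans_le (norm_add_le _ _)
  -- Absorbing `0.1 ‖x - w‖` leaves factors `1 / 0.9 ≤ 1.125` and `1.05 / 0.9 ≤ 1.2`.
  linarith [norm_nonneg (restr Tᶜ x), norm_nonneg e]

/-- The effect of one iteration, with `T` the merged support. -/
theorem IsStep.exists_bounds {Φ : Matrix (Fin m) (Fin d) ℂ} {s : ℕ} (h : RIP Φ (4 * s) 0.1)
    {x a a' : EuclideanSpace ℂ (Fin d)} {e : EuclideanSpace ℂ (Fin m)} (hx : IsSparse s x)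
    (ha : IsSparse s a) (hs : IsStep Φ (app Φ x + e) s a a') :
    IsSparse s a' ∧ ∃ T : Finset (Fin d),
      ‖restr Tᶜ x‖ ≤ 0.2 * ‖x - a‖ + 2.1 * ‖e‖ ∧
      ‖x - a'‖ ≤ 2.25 * ‖restr Tᶜ x‖ + 2.4 * ‖e‖ := by
  obtain ⟨u, w, hu, hw, ha'⟩ := hs
  refine ⟨ha'.isSparse, supp u ∪ supp a, ?_, ?_⟩
  · have hr : IsSparse (2 * s) (x - a) := by
      have h1 := Finset.card_le_card
        (supp_sub_subset (u := x) (v := a) Finset.subset_union_left Finset.subset_union_right)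
      have h2 := Finset.card_union_le (supp x) (supp a)
      unfold IsSparse at *
      omega
    rw [show app Φ x + e - app Φ a = app Φ (x - a) + e by rw [app_sub]; abel] at hu
    have e1 : restr (supp u ∪ supp a)ᶜ x = restr (supp u ∪ supp a)ᶜ (x - a) := by
      ext i
      by_cases hi : a i = 0 <;> simp [restr_apply, mem_supp, hi]
    rw [e1]
    exact (norm_restr_mono (Finset.compl_subset_compl.2 Finset.subset_union_left) _).trans
      (norm_restr_compl_le_of_isHead h hr hu)
  · have hT : (supp u ∪ supp a).card ≤ 3 * s := by
      have h1 := Finset.card_union_le (supp u) (supp a)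
      have h2 := hu.isSparse
      unfold IsSparse at *
      omega
    have h1 := hw.1.norm_sub_le h hx hT
    -- Pruning at most doubles the error, whence `2.25 = 2 * 1.125` and `2.4 = 2 * 1.2`.
    have h2 := ha'.norm_sub_le hx
    have h3 : ‖x - a'‖ ≤ ‖x - w‖ + ‖w - a'‖ := norm_sub_le_norm_sub_add_norm_sub _ _ _
    linarith

/-! ### Iteration count independent of the signal -/

/-- A nonzero restriction of a sparse vector is comparable with one of its components. -/
theorem exists_norm_le_norm_restr {s : ℕ} {x : EuclideanSpace ℂ (Fin d)} (hx : IsSparse s x)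
    (T : Finset (Fin d)) (h : 0 < ‖restr T x‖) :
    ∃ i ∈ supp x, ‖x i‖ ≤ ‖restr T x‖ ∧ ‖restr T x‖ ≤ s * ‖x i‖ := by
  have e1 : ‖restr T x‖ ^ 2 = ∑ i ∈ T ∩ supp x, ‖x i‖ ^ 2 := by
    rw [norm_restr_sq]
    refine (Finset.sum_subset Finset.inter_subset_left fun i hi hn => ?_).symm
    have : x i = 0 := by
      by_contra hc
      exact hn (Finset.mem_inter.2 ⟨hi, mem_supp.2 hc⟩)
    simp [this]
  rcases (T ∩ supp x).eq_empty_or_nonempty with h0 | hne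
  · rw [h0, Finset.sum_empty] at e1
    nlinarith
  obtain ⟨p, hp, hmax⟩ := Finset.exists_max_image (T ∩ supp x) (fun j => ‖x j‖) hne
  refine ⟨p, (Finset.mem_inter.1 hp).2, ?_, ?_⟩
  · refine le_of_sq_le_sq ?_ (norm_nonneg _)
    rw [e1]
    exact Finset.single_le_sum (f := fun i => ‖x i‖ ^ 2) (fun i _ => sq_nonneg _) hp
  · refine le_of_sq_le_sq ?_ (by positivity)
    have h1 : ∑ i ∈ T ∩ supp x, ‖x i‖ ^ 2 ≤ (T ∩ supp x).card • ‖x p‖ ^ 2 :=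
      Finset.sum_le_card_nsmul _ _ _ fun i hi => pow_le_pow_left₀ (norm_nonneg _) (hmax i hi) 2
    have h2 : (T ∩ supp x).card ≤ s := (Finset.card_le_card Finset.inter_subset_right).trans hx
    have h3 : 1 ≤ (T ∩ supp x).card := hne.card_pos
    -- The sharp factor would be `√s`; the cruder `s` is enough.
    have h4 : ((T ∩ supp x).card : ℝ) ≤ (s : ℝ) ^ 2 := by
      exact_mod_cast h2.trans (Nat.le_self_pow two_ne_zero s)
    rw [e1, mul_pow]
    rw [nsmul_eq_mul] at h1
    exact h1.trans (mul_le_mul_of_nonneg_right h4 (sq_nonneg _))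

/-- A sequence that is halved up to a perturbation `c`, and that is comparable with one of at most
`s` numbers whenever it is positive, is of the order of `c` after `(s + 1) ^ 2` steps. -/
theorem le_of_halving {ι : Type*} {S : Finset ι} {s : ℕ} (hS : S.card ≤ s) {f : ι → ℝ}
    {M : ℕ → ℝ} {c : ℝ} (hc : 0 ≤ c) (hM : ∀ k, M (k + 1) ≤ M k / 2 + c)
    (hf : ∀ k, 0 < M k → ∃ i ∈ S, f i ≤ M k ∧ M k ≤ s * f i) {k : ℕ} (hk : (s + 1) ^ 2 ≤ k) :
    M k ≤ 4 * c := by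
  have hmono : ∀ k, M k ≤ 4 * c → ∀ j, M (k + j) ≤ 4 * c := by
    intro k h0 j
    induction j with
    | zero => exact h0
    | succ j ih => have := hM (k + j); rw [← add_assoc]; linarith
  have hgeom : ∀ k j, M (k + j) ≤ M k / 2 ^ j + 2 * c := by
    intro k j
    induction j with
    | zero => simp; linarith
    | succ j ih =>
      have := hM (k + j)
      rw [← add_assoc, pow_succ, ← div_div]
      linarith
  -- After `p` blocks of `s + 1` steps, either the noise level is reached or at least `p` of the `s`
  -- slots for values `f i ≤ M` are lost.
  have hmain : ∀ p : ℕ, M (p * (s + 1)) ≤ 4 * c ∨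
      (S.filter fun i => f i ≤ M (p * (s + 1))).card + p ≤ s := by
    intro p
    induction p with
    | zero => exact Or.inr ((Finset.card_filter_le _ _).trans hS)
    | succ p ih =>
      rw [Nat.succ_mul]
      rcases ih with ih | ih
      · exact Or.inl (hmono _ ih _)
      by_cases h1 : M (p * (s + 1) + (s + 1)) ≤ 4 * c
      · exact Or.inl h1
      by_cases h2 : M (p * (s + 1)) ≤ 4 * c
      · exact Or.inl (hmono _ h2 _)
      push Not at h1 h2
      right
      obtain ⟨i, hi, hi1, hi2⟩ := hf (p * (s + 1)) (by linarith)
      have h3 := hgeom (p * (s + 1)) (s + 1)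
      set M₀ := M (p * (s + 1))
      set M₁ := M (p * (s + 1) + (s + 1))
      have hs2 : (s : ℝ) ≤ 2 ^ s := by exact_mod_cast Nat.lt_two_pow_self.le
      have hfi : 0 ≤ f i := by
        by_contra! hneg
        have : (s : ℝ) * f i ≤ 0 := mul_nonpos_of_nonneg_of_nonpos (Nat.cast_nonneg s) hneg.le
        linarith
      have h4 : M₀ / 2 ^ (s + 1) ≤ f i / 2 := by
        rw [pow_succ, ← div_div]
        refine div_le_div_of_nonneg_right ?_ (by norm_num)
        rw [div_le_iff₀ (by positivity), mul_comm]
        exact hi2.trans (mul_le_mul_of_nonneg_right hs2 hfi)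
      -- `M₁ ≤ f i / 2 + 2 * c` while `2 * c < M₁ / 2`, so index `i` leaves the filtered set.
      have h5 : M₁ < f i := by linarith
      have h6 : (S.filter fun j => f j ≤ M₁) ⊂ S.filter fun j => f j ≤ M₀ := by
        rw [Finset.ssubset_iff_of_subset]
        · exact ⟨i, Finset.mem_filter.2 ⟨hi, hi1⟩, fun hn =>
            absurd (Finset.mem_filter.1 hn).2 (not_le.2 h5)⟩
        · intro j hj
          rw [Finset.mem_filter] at hj ⊢
          exact ⟨hj.1, by linarith⟩
      have := Finset.card_lt_card h6
      omega
  obtain ⟨j, rfl⟩ := Nat.exists_eq_add_of_le hk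
  refine hmono _ ?_ j
  rw [pow_two]
  rcases hmain (s + 1) with h | h
  · exact h
  · omega

/-- A run of CoSaMP recovers every sparse vector up to the size of the noise in a number of
iterations that depends on the sparsity level alone. -/
theorem IsRun.norm_sub_le {Φ : Matrix (Fin m) (Fin d) ℂ} {s : ℕ} (h : RIP Φ (4 * s) 0.1)
    {x : EuclideanSpace ℂ (Fin d)} {e : EuclideanSpace ℂ (Fin m)} (hx : IsSparse s x)
    {a : ℕ → EuclideanSpace ℂ (Fin d)} (ha : IsRun Φ (app Φ x + e) s a) {k : ℕ}
    (hk : (s + 1) ^ 2 + 1 ≤ k) : ‖a k - x‖ ≤ 30 * ‖e‖ := by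
  have hsp : ∀ k, IsSparse s (a k) := by
    intro k
    induction k with
    | zero => simp [ha.1, IsSparse, supp]
    | succ k ih => exact ((ha.2 k).exists_bounds h hx ih).1
  choose T hT1 hT2 using fun k => ((ha.2 k).exists_bounds h hx (hsp k)).2
  -- The merged support of step `n` controls the approximation `a (n + 1)`; this costs the extra
  -- iteration.
  obtain ⟨n, rfl⟩ : ∃ n, k = n + 1 := ⟨k - 1, by omega⟩
  have hM := le_of_halving (S := supp x) (s := s) hx (f := fun i => ‖x i‖)
    (M := fun k => ‖restr (T k)ᶜ x‖) (c := 3 * ‖e‖) (by positivity)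
    -- `0.2 * (2.25 M + 2.4 ‖e‖) + 2.1 ‖e‖ = 0.45 M + 2.58 ‖e‖`.
    (fun k => by
      have h1 := hT1 (k + 1)
      have h2 := hT2 k
      have := norm_nonneg (restr (T k)ᶜ x)
      have := norm_nonneg e
      linarith)
    (fun k hk => exists_norm_le_norm_restr hx _ hk) (k := n) (by omega)
  have h2 := hT2 n
  rw [norm_sub_rev]
  have := norm_nonneg e
  -- `2.25 * (4 * 3) + 2.4 = 29.4`.
  linarith

/-! ### Spectral norms of column submatrices -/

theorem columnNorm_nonneg (A : Matrix (Fin m) (Fin d) ℂ) (T : Finset (Fin d)) :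
    0 ≤ columnNorm A T := by
  open scoped Matrix.Norms.L2Operator in
  exact norm_nonneg _

/-- Multiplication of a column submatrix with the restriction of a vector supported in `T`. -/
theorem submatrix_mulVec_eq (A : Matrix (Fin m) (Fin d) ℂ) {T : Finset (Fin d)}
    {z : EuclideanSpace ℂ (Fin d)} (hz : supp z ⊆ T) :
    (A.submatrix id fun i : {i // i ∈ T} => (i : Fin d)).mulVec (fun i => z i) = A.mulVec z := by
  funext j
  simp only [Matrix.mulVec, dotProduct, Matrix.submatrix_apply, id]
  rw [Finset.sum_coe_sort T fun i => A j i * z i]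
  exact Finset.sum_subset (Finset.subset_univ _) fun i _ hi => by
    rw [supp_subset_iff.1 hz i hi, mul_zero]

theorem norm_coe_eq {T : Finset (Fin d)} {z : EuclideanSpace ℂ (Fin d)} (hz : supp z ⊆ T) :
    ‖(WithLp.toLp 2 fun i : {i // i ∈ T} => z i : EuclideanSpace ℂ {i // i ∈ T})‖ = ‖z‖ := by
  rw [← sq_eq_sq₀ (norm_nonneg _) (norm_nonneg _), EuclideanSpace.norm_sq_eq,
    EuclideanSpace.norm_sq_eq]
  refine (Finset.sum_coe_sort T fun i => ‖z i‖ ^ 2).trans ?_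
  exact Finset.sum_subset (Finset.subset_univ _) fun i _ hi => by
    simp [supp_subset_iff.1 hz i hi]

theorem norm_app_le_columnNorm (A : Matrix (Fin m) (Fin d) ℂ) {T : Finset (Fin d)}
    {z : EuclideanSpace ℂ (Fin d)} (hz : supp z ⊆ T) :
    ‖app A z‖ ≤ columnNorm A T * ‖z‖ := by
  open scoped Matrix.Norms.L2Operator in
  have h := Matrix.l2_opNorm_mulVec (A.submatrix id fun i : {i // i ∈ T} => (i : Fin d))
    (WithLp.toLp 2 fun i : {i // i ∈ T} => z i)
  rw [norm_coe_eq hz] at h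
  rw [app, ← submatrix_mulVec_eq A hz]
  exact h

theorem columnNorm_le {A : Matrix (Fin m) (Fin d) ℂ} {T : Finset (Fin d)} {c : ℝ} (hc : 0 ≤ c)
    (h : ∀ z, supp z ⊆ T → ‖app A z‖ ≤ c * ‖z‖) : columnNorm A T ≤ c := by
  open scoped Matrix.Norms.L2Operator in
  rw [columnNorm, Matrix.l2_opNorm_def]
  refine ContinuousLinearMap.opNorm_le_bound _ hc fun v => ?_
  let z : EuclideanSpace ℂ (Fin d) := WithLp.toLp 2 fun i => if hi : i ∈ T then v ⟨i, hi⟩ else 0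
  have hz : supp z ⊆ T := supp_subset_iff.2 fun i hi => by simp [z, hi]
  have hv : v = WithLp.toLp 2 fun i : {i // i ∈ T} => z i := by
    ext i
    simp [z]
  have h1 := h z hz
  rw [app, ← submatrix_mulVec_eq A hz, ← norm_coe_eq hz, ← hv] at h1
  rw [hv] at h1 ⊢
  exact h1

theorem norm_app_le_subNorm (A : Matrix (Fin m) (Fin d) ℂ) {k : ℕ}
    {z : EuclideanSpace ℂ (Fin d)} (hz : IsSparse k z) : ‖app A z‖ ≤ subNorm A k * ‖z‖ :=
  (norm_app_le_columnNorm A subset_rfl).trans <| mul_le_mul_of_nonneg_right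
    (le_ciSup (f := fun T : {T : Finset (Fin d) // T.card ≤ k} => columnNorm A T)
      (Set.finite_range _).bddAbove ⟨supp z, hz⟩) (norm_nonneg _)

theorem subNorm_nonneg (A : Matrix (Fin m) (Fin d) ℂ) (k : ℕ) : 0 ≤ subNorm A k :=
  Real.iSup_nonneg fun _ => columnNorm_nonneg _ _

theorem RIP.subNorm_le {A : Matrix (Fin m) (Fin d) ℂ} {k : ℕ} {δ : ℝ} (h : RIP A k δ) :
    subNorm A k ≤ √(1 + δ) := by
  have : Nonempty {T : Finset (Fin d) // T.card ≤ k} := ⟨⟨∅, by simp⟩⟩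
  refine ciSup_le fun T => columnNorm_le (Real.sqrt_nonneg _) fun z hz => ?_
  have := (h z ((Finset.card_le_card hz).trans T.2)).2
  rw [← Real.sqrt_sq (norm_nonneg (app A z)), ← Real.sqrt_sq (norm_nonneg z),
    ← Real.sqrt_mul' _ (sq_nonneg _)]
  exact Real.sqrt_le_sqrt this

/-! ### Perturbation of the RIP and the main result -/

/-- A small relative perturbation preserves the restricted isometry property. -/
theorem RIP.perturb {A Φ : Matrix (Fin m) (Fin d) ℂ} {k : ℕ} {δ : ℝ} (h : RIP A k δ)
    (hδ : δ ≤ 1.1 / (1 + relPert A Φ k) ^ 2 - 1) : RIP Φ k 0.1 := by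
  intro z hz
  rcases eq_or_lt_of_le (norm_nonneg z) with h0 | hpos
  · have hz0 : z = 0 := norm_eq_zero.1 h0.symm
    have : app Φ 0 = 0 := map_zero (Matrix.toEuclideanLin Φ)
    simp [hz0, this]
  obtain ⟨hl, hu⟩ := h z hz
  -- A nonzero sparse `z` makes the two RIP bounds comparable.
  have hδ0 : 0 ≤ δ := by nlinarith [pow_pos hpos 2]
  have hzA := norm_app_le_subNorm A hz
  have hε : 0 ≤ relPert A Φ k := div_nonneg (subNorm_nonneg _ _) (subNorm_nonneg _ _)
  set ε := relPert A Φ k with hεdef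
  have hδ1 : (1 + δ) * (1 + ε) ^ 2 ≤ 1.1 := by
    rw [← le_div_iff₀ (by positivity)]
    linarith
  have hδ2 : δ ≤ 0.1 := by nlinarith [mul_nonneg hδ0 hε, mul_nonneg hε hε]
  -- Otherwise `relPert` is a division by zero, with value 0, and would say nothing about `A - Φ`.
  have hA0 : 0 < subNorm A k := by
    rcases eq_or_lt_of_le (subNorm_nonneg A k) with h0 | h0
    · rw [← h0, zero_mul] at hzA
      have : ‖app A z‖ = 0 := le_antisymm hzA (norm_nonneg _)
      rw [this] at hl
      nlinarith [pow_pos hpos 2]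
    · exact h0
  have hr := h.subNorm_le
  set r := √(1 + δ)
  have hr2 : r ^ 2 = 1 + δ := Real.sq_sqrt (by linarith)
  have hr0 : 0 ≤ r := Real.sqrt_nonneg _
  have hr1 : 1 ≤ r := Real.one_le_sqrt.2 (by linarith)
  have hN : subNorm (A - Φ) k ≤ ε * r := by
    have : subNorm (A - Φ) k = ε * subNorm A k := (div_mul_cancel₀ _ hA0.ne').symm
    rw [this]
    exact mul_le_mul_of_nonneg_left hr hε
  have hD : ‖app A z - app Φ z‖ ≤ ε * r * ‖z‖ := by
    rw [← sub_app]
    exact (norm_app_le_subNorm _ hz).trans (mul_le_mul_of_nonneg_right hN hpos.le)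
  have hAr : ‖app A z‖ ≤ r * ‖z‖ := hzA.trans (mul_le_mul_of_nonneg_right hr hpos.le)
  have hq : (r * (1 + ε)) ^ 2 ≤ 1.1 := by rw [mul_pow, hr2]; exact hδ1
  constructor
  · have h1 : ‖app A z‖ ≤ ‖app Φ z‖ + ε * r * ‖z‖ := by
      linarith [norm_sub_norm_le (app A z) (app Φ z)]
    have hl' : √(1 - δ) * ‖z‖ ≤ ‖app A z‖ := by
      refine le_of_sq_le_sq ?_ (norm_nonneg _)
      rw [mul_pow, Real.sq_sqrt (by linarith)]
      exact hl
    set l := √(1 - δ)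
    have hl2 : l ^ 2 = 1 - δ := Real.sq_sqrt (by linarith)
    have hl0 : 0 ≤ l := Real.sqrt_nonneg _
    -- Concavity of the square root: `l ^ 2 + r ^ 2 = 2 = 0.9 + 1.1`, so factoring differences of
    -- squares gives `√1.1 - r ≤ l - √0.9`, and `ε * r ≤ √1.1 - r`.
    have hll : √0.9 ≤ l - ε * r := by
      have ht2 : √1.1 ^ 2 = (1.1 : ℝ) := Real.sq_sqrt (by norm_num)
      have hp2 : √0.9 ^ 2 = (0.9 : ℝ) := Real.sq_sqrt (by norm_num)
      have hrt : r * (1 + ε) ≤ √1.1 := Real.le_sqrt_of_sq_le hq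
      have hpl : √0.9 ≤ l := Real.sqrt_le_sqrt (by linarith)
      have hpt : √0.9 ≤ √(1.1 : ℝ) := Real.sqrt_le_sqrt (by norm_num)
      have hlr : l ≤ r := Real.sqrt_le_sqrt (by linarith)
      have h2 : (√1.1 - r) * (√1.1 + r) ≤ (l - √0.9) * (√1.1 + r) := by
        calc (√1.1 - r) * (√1.1 + r) = (l - √0.9) * (l + √0.9) := by
              linear_combination ht2 - hr2 - hl2 + hp2
          _ ≤ (l - √0.9) * (√1.1 + r) :=
              mul_le_mul_of_nonneg_left (by linarith) (by linarith)
      have h3 := le_of_mul_le_mul_right h2 (by positivity)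
      linarith
    have h2 : √0.9 * ‖z‖ ≤ ‖app Φ z‖ := by
      have := mul_le_mul_of_nonneg_right hll hpos.le
      rw [sub_mul] at this
      linarith
    have h3 := pow_le_pow_left₀ (by positivity) h2 2
    rw [mul_pow, Real.sq_sqrt (by norm_num)] at h3
    linarith
  · have h1 : ‖app Φ z‖ ≤ r * (1 + ε) * ‖z‖ := by
      have := norm_sub_norm_le (app Φ z) (app A z)
      rw [norm_sub_rev] at this
      linarith
    have h2 := pow_le_pow_left₀ (norm_nonneg _) h1 2
    rw [mul_pow] at h2
    linarith [mul_le_mul_of_nonneg_right hq (sq_nonneg ‖z‖)]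

end CoSaMP

theorem corollary2p3 :
    ∃ C : ℝ, 0 < C ∧ ∀ s : ℕ, ∃ K : ℕ,
      ∀ (m d : ℕ) (A Φ : Matrix (Fin m) (Fin d) ℂ) (δ : ℝ),
        CoSaMP.RIP A (4 * s) δ →
        δ ≤ 1.1 / (1 + CoSaMP.relPert A Φ (4 * s)) ^ 2 - 1 →
        ∀ (x : EuclideanSpace ℂ (Fin d)) (b e y : EuclideanSpace ℂ (Fin m)),
          CoSaMP.IsSparse s x →
          b = CoSaMP.app A x →
          y = b + e →
          ∀ a : ℕ → EuclideanSpace ℂ (Fin d), CoSaMP.IsRun Φ y s a →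
            ∀ k : ℕ, K ≤ k →
              ‖a k - x‖ ≤ C * (CoSaMP.subNorm (A - Φ) s * ‖b‖ + ‖e‖) := by
  -- The estimates yield `30 * 1.2 = 36` for the matrix term and 30 for `‖e‖`.
  refine ⟨40, by norm_num, fun s => ⟨(s + 1) ^ 2 + 1, ?_⟩⟩
  rintro m d A Φ δ hA hδ x b e y hx rfl rfl a ha k hk
  have hΦ := hA.perturb hδ
  have hy : CoSaMP.app A x + e = CoSaMP.app Φ x + (CoSaMP.app (A - Φ) x + e) := by
    rw [CoSaMP.sub_app]
    abel
  rw [hy] at ha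
  have h1 := ha.norm_sub_le hΦ hx hk
  have h2 := norm_add_le (CoSaMP.app (A - Φ) x) e
  have h3 := CoSaMP.norm_app_le_subNorm (A - Φ) hx
  have hN := CoSaMP.subNorm_nonneg (A - Φ) s
  have hδ2 : δ ≤ 0.1 := by
    have hε : 0 ≤ CoSaMP.relPert A Φ (4 * s) :=
      div_nonneg (CoSaMP.subNorm_nonneg _ _) (CoSaMP.subNorm_nonneg _ _)
    have : 1.1 / (1 + CoSaMP.relPert A Φ (4 * s)) ^ 2 ≤ (1.1 : ℝ) :=
      div_le_self (by norm_num) (one_le_pow₀ (by linarith))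
    linarith
  -- The lower RIP bound of `A` with `δ ≤ 0.1` suffices, as `1.2 ^ 2 * 0.9 ≥ 1`.
  have h4 : ‖x‖ ≤ 1.2 * ‖CoSaMP.app A x‖ := by
    refine le_of_sq_le_sq ?_ (by positivity)
    have := (hA x (le_trans hx (by omega))).1
    nlinarith [sq_nonneg ‖x‖]
  have h5 := mul_le_mul_of_nonneg_left h4 hN
  have h6 : 0 ≤ CoSaMP.subNorm (A - Φ) s * ‖CoSaMP.app A x‖ := by positivity
  have h7 := norm_nonneg e
  linarith
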